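/- **Theorem.** A *QAC circuit* is a product $C=M_d\cdots M_1$ of layers, where each layer is a product of gates acting on pairwise disjoint sets of qubits, and each gate is either an arbitrary single-qubit unitary or a generalized Toffoli gate $|x_1,\dots,x_k\rangle|b\rangle\mapsto|x_1,\dots,x_k\rangle|b\oplus(x_1\wedge\cdots\wedge x_k)\rangle$ with $k\ge 1$. Its *depth* is $d$, and its *size* is the total number of gates plus the number of qubits it operates on. A circuit with $a$ ancilla qubits is run on an input $z$ by applying $C$ to $|z\rangle|0^a\rangle|0\rangle$ and measuring the last qubit in the computational basis; the result is its output. A function $f\colon\{0,1\}^n\to\{0,1\}$ is *symmetric* if $f(x)$ depends only on the Hamming weight of $x$. There are absolute constants $d,K\in\mathbb N$ and $c>0$ such that for every $n\ge 0$, every symmetric function $f\colon\{0,1\}^n\to\{0,1\}$ and every integer $r\ge 1$, there are a number $a$ and a QAC circuit $C$ with $a$ ancilla qubits, of depth at most $d$ and size at most $K\,(r(n+1))^K$, which takes $m=r(n+1)^3$ identical copies $x,x,\dots,x$ of an $n$-bit string $x$ as its input and satisfies, for every $x\in\{0,1\}^n$: * (completeness $1$) if $f(x)=1$, then $C$ outputs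 $1$ with probability $1$; * (soundness $2^{-\Omega(r)}$) if $f(x)=0$, then $C$ outputs $1$ with probability at most $2^{-cr}$, that is, it outputs $0$ with probability at least $1-2^{-cr}$. -/

import Mathlib

namespace QAC

/-- The Hamming weight of a bit string. -/
def hammingWeight {n : ℕ} (x : Fin n → Bool) : ℕ :=
  (Finset.univ.filter fun i => x i = true).card

/-- A Boolean function is symmetric if its value depends only on the Hamming weight of the input. -/
def IsSymmetric {n : ℕ} (f : (Fin n → Bool) → Bool) : Prop :=
  ∀ x y, hammingWeight x = hammingWeight y → f x = f y

/-- Vectors of the Hilbert space of a register of qubits labelled by `Q`, given by their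
amplitudes in the computational basis (`false` stands for 0 and `true` for 1). -/
abbrev StateVec (Q : Type*) : Type _ := (Q → Bool) → ℂ

/-- The computational basis state `|z⟩`. -/
def basisState {Q : Type*} [Fintype Q] [DecidableEq Q] (z : Q → Bool) : StateVec Q :=
  fun y => if y = z then 1 else 0

/-- The gates of a QAC circuit: an arbitrary single-qubit unitary `U` on a qubit `q`, or a
generalized Toffoli gate `|x⟩|b⟩ ↦ |x⟩|b ⊕ AND(x)⟩` with a nonempty set of control qubits and a
target qubit which is not among them. -/
inductive Gate (Q : Type*) where
  | single (q : Q) (U : Matrix.unitaryGroup Bool ℂ)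
  | toffoli (controls : Finset Q) (target : Q) (hne : controls.Nonempty)
      (htarget : target ∉ controls)

/-- The set of qubits a gate operates on. -/
def Gate.support {Q : Type*} [DecidableEq Q] : Gate Q → Finset Q
  | .single q _ => {q}
  | .toffoli controls target _ _ => insert target controls

/-- The action of a gate, tensored with the identity on all other qubits, on a state vector.
The Toffoli gate permutes the computational basis by an involution, so the new amplitude at `y`
is the old amplitude at the image of `y`. -/
noncomputable def Gate.apply {Q : Type*} [DecidableEq Q] : Gate Q → StateVec Q → StateVec Q
  | .single q U, ψ => fun y =>
      ∑ b : Bool, (U : Matrix Bool Bool ℂ) (y q) b * ψ (Function.update y q b)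
  | .toffoli controls target _ _, ψ => fun y =>
      ψ (Function.update y target (xor (y target) (decide (∀ c ∈ controls, y c = true))))

/-- A QAC circuit on the qubits `Q`: a list of layers, applied from the first to the last, each
layer being a collection of gates which operate on pairwise disjoint sets of qubits. -/
structure Circuit (Q : Type*) [DecidableEq Q] where
  layers : List (List (Gate Q))
  disjoint : ∀ L ∈ layers, L.Pairwise fun g h => Disjoint g.support h.support

namespace Circuit

/-- The number of layers. -/
def depth {Q : Type*} [DecidableEq Q] (C : Circuit Q) : ℕ :=
  C.layers.length

/-- The total number of gates and qubits. -/
def size {Q : Type*} [Fintype Q] [DecidableEq Q] (C : Circuit Q) : ℕ :=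
  (C.layers.map List.length).sum + Fintype.card Q

/-- The action of the circuit on a state vector. -/
noncomputable def apply {Q : Type*} [DecidableEq Q] (C : Circuit Q) (ψ : StateVec Q) : StateVec Q :=
  C.layers.flatten.foldl (fun φ g => g.apply φ) ψ

end Circuit

/-- The probability that measuring the qubit `q` of the state `ψ` in the computational basis
yields `b`. -/
noncomputable def measureProb {Q : Type*} [Fintype Q] [DecidableEq Q]
    (ψ : StateVec Q) (q : Q) (b : Bool) : ℝ :=
  ∑ y : Q → Bool, if y q = b then ‖ψ y‖ ^ 2 else 0

/-- The qubits of a circuit with input bits labelled by `ι` and `a` ancillas: the input register,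
the ancilla register, and the output qubit, which comes last. -/
abbrev Register (ι : Type*) (a : ℕ) : Type _ := ι ⊕ (Fin a ⊕ Unit)

/-- The output qubit. -/
def outputQubit {ι : Type*} {a : ℕ} : Register ι a := Sum.inr (Sum.inr ())

/-- The initial state `|z⟩|0^a⟩|0⟩` on the input `z`. -/
def initialState {ι : Type*} [Fintype ι] [DecidableEq ι] (a : ℕ) (z : ι → Bool) :
    StateVec (Register ι a) :=
  basisState (Sum.elim z fun _ => false)

/-- The probability that the circuit outputs `b` on the input `z`: run it on `|z⟩|0^a⟩|0⟩` and
measure the output qubit. -/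
noncomputable def Circuit.outputProb {ι : Type*} [Fintype ι] [DecidableEq ι] {a : ℕ}
    (C : Circuit (Register ι a)) (z : ι → Bool) (b : Bool) : ℝ :=
  measureProb (C.apply (initialState a z)) outputQubit b

/-- The input consisting of `m` identical copies of `x`; the bit labelled by `(j, i)` is the
`i`-th bit of the `j`-th copy. -/
def copies {n : ℕ} (m : ℕ) (x : Fin n → Bool) : Fin m × Fin n → Bool :=
  fun p => x p.2

end QAC

/-! Fix a weight k and let j be the weight of x. A single copy of x allows a test that passes with
certainty when j = k. Every bit of x equal to 1 damps the amplitude of |1⟩ on its work qubit by l =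
2^(-1/(2(k+1))), and one constant bit 1 is added, so the all-ones string of the work qubits has
amplitude c = l^(j+1), and c² = 2^(-(j+1)/(k+1)) equals 1/2 exactly when j = k. The damping is done
by an involution applied to the all-ones string. Marking all-ones in an extra qubit and applying the
involution again leaves, on the all-ones string, the extra qubit in the unnormalized state (1 -
c²)|0⟩ + c²|1⟩. Its overlap with (|1⟩ - |0⟩)/√2 is (2c² - 1)/√2. Rejecting on this outcome gives a
test that fails with probability (2c² - 1)²/2 (`measureProb_testLayers`, `measureProb_weightTest`),
which is zero for j = k and at least (k - j)²/(8(n+1)²) otherwise.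

The circuit tests every accepted weight k on its own r(n+1)² copies and outputs the OR over k of the
AND of the test results, as two levels of NAND. The blocks are disjoint, so the state before each
NAND is a product state and probabilities multiply (`measureProb_nandLayers`). If f(x) = 1, the
group of the true weight passes surely. If f(x) = 0, that weight is not tested, and a group at
distance |k - j| passes with probability at most e^(-r|k-j|/8) (`passProb_pow_le`). These bounds
decay geometrically on both sides of j, so the probability that no group passes is bounded below
independently of n (`exp_le_prod_one_sub`). A union bound would be vacuous for small r, whereas the
product stays positive; `exists_rate` then yields one rate c for all r. -/

namespace QAC

variable {Q W T E : Type*}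

/-! ### Linearity, norm preservation and relabelling of gates. -/

section Gates

variable [DecidableEq Q] [DecidableEq W]

/-- The total squared norm of a state vector. -/
noncomputable def normSqSum [Fintype Q] (ψ : StateVec Q) : ℝ := ∑ y, ‖ψ y‖ ^ 2

/-- Apply a list of gates, from the first to the last. -/
noncomputable def runGates (gs : List (Gate Q)) (ψ : StateVec Q) : StateVec Q :=
  gs.foldl (fun φ g => g.apply φ) ψ

@[simp] theorem runGates_nil (ψ : StateVec Q) : runGates [] ψ = ψ := rfl

@[simp] theorem runGates_cons (g : Gate Q) (gs : List (Gate Q)) (ψ : StateVec Q) :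
    runGates (g :: gs) ψ = runGates gs (g.apply ψ) := rfl

@[simp] theorem runGates_append (gs hs : List (Gate Q)) (ψ : StateVec Q) :
    runGates (gs ++ hs) ψ = runGates hs (runGates gs ψ) := by
  simp [runGates, List.foldl_append]

theorem Gate.apply_add (g : Gate Q) (ψ φ : StateVec Q) :
    g.apply (ψ + φ) = g.apply ψ + g.apply φ := by
  cases g <;> ext y <;> simp [Gate.apply]; ring

theorem Gate.apply_smul (g : Gate Q) (c : ℂ) (ψ : StateVec Q) :
    g.apply (c • ψ) = c • g.apply ψ := by
  cases g <;> ext y <;> simp [Gate.apply]; ring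

theorem runGates_add (gs : List (Gate Q)) (ψ φ : StateVec Q) :
    runGates gs (ψ + φ) = runGates gs ψ + runGates gs φ := by
  induction gs generalizing ψ φ with
  | nil => rfl
  | cons g gs ih => simp [Gate.apply_add, ih]

theorem runGates_smul (gs : List (Gate Q)) (c : ℂ) (ψ : StateVec Q) :
    runGates gs (c • ψ) = c • runGates gs ψ := by
  induction gs generalizing ψ with
  | nil => rfl
  | cons g gs ih => simp [Gate.apply_smul, ih]

theorem sum_normSq_unitary (U : Matrix.unitaryGroup Bool ℂ) (v : Bool → ℂ) :
    ∑ b, ‖∑ b', (U : Matrix Bool Bool ℂ) b b' * v b'‖ ^ 2 = ∑ b, ‖v b‖ ^ 2 := by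
  have key : ∀ w : Bool → ℂ, ((∑ b, ‖w b‖ ^ 2 : ℝ) : ℂ) = star w ⬝ᵥ w := by
    intro w
    simp [dotProduct, ← Complex.normSq_eq_conj_mul_self, Complex.normSq_eq_norm_sq]
  have hU : (U : Matrix Bool Bool ℂ).conjTranspose * U = 1 :=
    Matrix.mem_unitaryGroup_iff'.1 U.2
  apply Complex.ofReal_injective
  rw [key v]
  have := key ((U : Matrix Bool Bool ℂ).mulVec v)
  rw [Matrix.star_mulVec, ← Matrix.dotProduct_mulVec, Matrix.mulVec_mulVec, hU,
    Matrix.one_mulVec] at this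
  exact this

/-- Flipping one bit of a bit string. -/
def flipBit (q : Q) : (Q → Bool) ≃ (Q → Bool) :=
  Function.Involutive.toPerm (fun y => Function.update y q (!(y q))) (by
    intro y; simp)

/-- Each string arises twice, from itself and from its flip at `q`. This groups a sum over all
strings by the fibres on which a single-qubit gate acts, without splitting the register. -/
theorem sum_sum_update [Fintype Q] (q : Q) (F : (Q → Bool) → ℝ) :
    ∑ y, ∑ b, F (Function.update y q b) = 2 * ∑ y, F y := by
  have h1 : ∀ y : Q → Bool,
      ∑ b, F (Function.update y q b) = F y + F (flipBit q y) := by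
    intro y
    have hf : ∀ b, y q = b → flipBit q y = Function.update y q (!b) := by
      rintro b rfl; rfl
    have hs : ∀ b, y q = b → Function.update y q b = y := by
      rintro b rfl; exact Function.update_eq_self q y
    cases h : y q
    · rw [hf _ h, Fintype.sum_bool, hs _ h, Bool.not_false, add_comm]
    · rw [hf _ h, Fintype.sum_bool, hs _ h, Bool.not_true]
  simp_rw [h1]
  rw [Finset.sum_add_distrib, Equiv.sum_comp (flipBit q) F]
  ring

/-- The permutation of the basis states given by a Toffoli gate. -/
def toffoliPerm (s : Finset Q) (t : Q) (ht : t ∉ s) : (Q → Bool) ≃ (Q → Bool) :=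
  Function.Involutive.toPerm
    (fun y => Function.update y t (xor (y t) (decide (∀ c ∈ s, y c = true)))) (by
      intro y
      have : ∀ b : Bool, (∀ c ∈ s, Function.update y t b c = true) ↔ ∀ c ∈ s, y c = true := by
        intro b
        refine forall₂_congr fun c hc => ?_
        rw [Function.update_of_ne]
        rintro rfl
        exact ht hc
      simp [this])

theorem normSqSum_apply [Fintype Q] (g : Gate Q) (ψ : StateVec Q) :
    normSqSum (g.apply ψ) = normSqSum ψ := by
  cases g with
  | single q U =>
    have h := sum_sum_update q fun y => ‖(Gate.single q U).apply ψ y‖ ^ 2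
    have h' := sum_sum_update q fun y => ‖ψ y‖ ^ 2
    have : ∀ y : Q → Bool,
        ∑ b, ‖(Gate.single q U).apply ψ (Function.update y q b)‖ ^ 2
          = ∑ b, ‖ψ (Function.update y q b)‖ ^ 2 := by
      intro y
      have := sum_normSq_unitary U fun b => ψ (Function.update y q b)
      simpa only [Gate.apply, Function.update_self, Function.update_idem] using this
    simp_rw [this] at h
    unfold normSqSum
    linarith
  | toffoli s t hne ht =>
    exact Equiv.sum_comp (toffoliPerm s t ht) fun y => ‖ψ y‖ ^ 2

theorem normSqSum_runGates [Fintype Q] (gs : List (Gate Q)) (ψ : StateVec Q) :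
    normSqSum (runGates gs ψ) = normSqSum ψ := by
  induction gs generalizing ψ with
  | nil => rfl
  | cons g gs ih => rw [runGates_cons, ih, normSqSum_apply]

theorem normSqSum_basisState [Fintype Q] (z : Q → Bool) : normSqSum (basisState z) = 1 := by
  simp [normSqSum, basisState, apply_ite]

theorem measureProb_add [Fintype Q] (ψ : StateVec Q) (q : Q) :
    measureProb ψ q true + measureProb ψ q false = normSqSum ψ := by
  unfold measureProb normSqSum
  rw [← Finset.sum_add_distrib]
  refine Finset.sum_congr rfl fun y _ => ?_
  cases y q <;> simp

/-- Lets the easier of the two outcomes be computed: in the constructions below, `false` is the one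
with a simple description. -/
theorem measureProb_true_runGates [Fintype Q] (gs : List (Gate Q)) (z : Q → Bool) (q : Q) :
    measureProb (runGates gs (basisState z)) q true
      = 1 - measureProb (runGates gs (basisState z)) q false := by
  rw [eq_sub_iff_add_eq, measureProb_add, normSqSum_runGates, normSqSum_basisState]

/-- Relabel the qubits of a gate along an embedding. -/
def Gate.map (f : W ↪ Q) : Gate W → Gate Q
  | .single q U => .single (f q) U
  | .toffoli s t hne ht => .toffoli (s.map f) (f t) (hne.map) (by simpa using ht)

theorem Gate.support_map (f : W ↪ Q) (g : Gate W) : (g.map f).support = g.support.map f := by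
  cases g <;> simp [Gate.map, Gate.support]

theorem Gate.support_nonempty (g : Gate Q) : g.support.Nonempty := by
  cases g <;> simp [Gate.support]

theorem extend_update (f : W ↪ Q) (y : Q → Bool) (q : W) (b : Bool) :
    Function.extend f (Function.update (y ∘ f) q b) y = Function.update y (f q) b := by
  ext p
  by_cases hp : ∃ a, f a = p
  · obtain ⟨a, rfl⟩ := hp
    rw [f.injective.extend_apply]
    by_cases ha : a = q
    · subst ha; simp
    · rw [Function.update_of_ne ha, Function.update_of_ne (by simpa using ha)]; rfl
  · rw [Function.extend_apply' _ _ _ hp, Function.update_of_ne]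
    rintro rfl
    exact hp ⟨q, rfl⟩

theorem Gate.map_apply (f : W ↪ Q) (g : Gate W) (ψ : StateVec Q) (y : Q → Bool) :
    (g.map f).apply ψ y = g.apply (fun w => ψ (Function.extend f w y)) (y ∘ f) := by
  cases g <;> simp [Gate.map, Gate.apply, extend_update]

/-- Gates in one layer act on pairwise disjoint sets of qubits. -/
def DisjointGates (L : List (Gate Q)) : Prop :=
  L.Pairwise fun g h => Disjoint g.support h.support

theorem DisjointGates.map {L : List (Gate W)} (hL : DisjointGates L) (f : W ↪ Q) :
    DisjointGates (L.map (Gate.map f)) := by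
  unfold DisjointGates at *
  rw [List.pairwise_map]
  refine hL.imp fun {g h} hd => ?_
  rw [Gate.support_map, Gate.support_map]
  exact (Finset.disjoint_map f).2 hd

/-- Choosing one qubit from each support gives distinct qubits. Hence size is controlled by depth
and the number of qubits alone. -/
theorem DisjointGates.length_le [Fintype Q] {L : List (Gate Q)} (hL : DisjointGates L) :
    L.length ≤ Fintype.card Q := by
  have key : ∀ L : List (Gate Q), DisjointGates L →
      ∃ s : Finset Q, L.length ≤ s.card ∧ ∀ q ∈ s, ∃ g ∈ L, q ∈ g.support := by
    intro L
    induction L with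
    | nil => exact fun _ => ⟨∅, by simp⟩
    | cons g L ih =>
      intro h
      obtain ⟨h1, h2⟩ := List.pairwise_cons.1 h
      obtain ⟨s, hs, hs'⟩ := ih h2
      obtain ⟨q, hq⟩ := g.support_nonempty
      have hqs : q ∉ s := fun hmem => by
        obtain ⟨g', hg', hq'⟩ := hs' q hmem
        exact Finset.disjoint_left.1 (h1 g' hg') hq hq'
      refine ⟨insert q s, by rw [Finset.card_insert_of_notMem hqs]; simpa using hs, ?_⟩
      intro p hp
      rcases Finset.mem_insert.1 hp with rfl | hp
      · exact ⟨g, by simp, hq⟩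
      · obtain ⟨g', hg', hq'⟩ := hs' p hp
        exact ⟨g', by simp [hg'], hq'⟩
  obtain ⟨s, hs, -⟩ := key L hL
  exact hs.trans (Finset.card_le_univ s)

end Gates

/-! ### Circuits run in parallel on disjoint blocks, and product states. -/

section Parallel

variable [DecidableEq T] [DecidableEq W] [DecidableEq E] [Fintype T]

/-- The embedding of one block into a family of blocks with an extra register. -/
def blockEmb (t : T) : W ↪ (T × W) ⊕ E :=
  ⟨fun w => Sum.inl (t, w), fun a b h => by simpa using h⟩

@[simp] theorem blockEmb_apply (t : T) (w : W) :
    (blockEmb t : W ↪ (T × W) ⊕ E) w = Sum.inl (t, w) := rfl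

/-- The embedding of the extra register. -/
def extraEmb : E ↪ (T × W) ⊕ E := ⟨Sum.inr, Sum.inr_injective⟩

@[simp] theorem extraEmb_apply (e : E) : (extraEmb : E ↪ (T × W) ⊕ E) e = Sum.inr e := rfl

/-- The tensor product of a state of every block and a state of the extra register. -/
def prodState (φ : T → StateVec W) (χ : StateVec E) : StateVec ((T × W) ⊕ E) :=
  fun y => (∏ t, φ t fun w => y (Sum.inl (t, w))) * χ fun e => y (Sum.inr e)

theorem extend_blockEmb_inl (t t' : T) (v : W → Bool) (y : (T × W) ⊕ E → Bool) :
    (fun w => Function.extend (blockEmb t) v y (Sum.inl (t', w)))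
      = if t' = t then v else fun w => y (Sum.inl (t', w)) := by
  ext w
  split_ifs with h
  · subst h
    exact (blockEmb (E := E) t').injective.extend_apply v y w
  · rw [Function.extend_apply']
    rintro ⟨a, ha⟩
    rw [blockEmb_apply, Sum.inl.injEq, Prod.mk.injEq] at ha
    exact h ha.1.symm

theorem extend_blockEmb_inr (t : T) (v : W → Bool) (y : (T × W) ⊕ E → Bool) (e : E) :
    Function.extend (blockEmb t) v y (Sum.inr e) = y (Sum.inr e) := by
  rw [Function.extend_apply']
  rintro ⟨a, ha⟩
  simp at ha

theorem block_apply_prodState (t : T) (g : Gate W) (φ : T → StateVec W) (χ : StateVec E) :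
    (g.map (blockEmb t)).apply (prodState φ χ)
      = prodState (Function.update φ t (g.apply (φ t))) χ := by
  ext y
  rw [Gate.map_apply]
  -- With all other qubits frozen at `y`, the product state is a multiple `c` of `φ t`, so linearity
  -- of the gate suffices.
  set c : ℂ := (∏ t' ∈ Finset.univ.erase t, φ t' fun w => y (Sum.inl (t', w)))
    * χ fun e => y (Sum.inr e) with hc
  have h1 : (fun v => prodState φ χ (Function.extend (blockEmb t) v y)) = c • φ t := by
    ext v
    simp only [prodState, extend_blockEmb_inr, extend_blockEmb_inl]
    rw [← Finset.mul_prod_erase _ _ (Finset.mem_univ t)]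
    simp only [if_true, hc, Pi.smul_apply, smul_eq_mul]
    rw [Finset.prod_congr rfl (g := fun t' => φ t' fun w => y (Sum.inl (t', w)))]
    · ring
    · intro t' ht'
      rw [if_neg (Finset.ne_of_mem_erase ht')]
  rw [h1, Gate.apply_smul]
  simp only [prodState]
  rw [← Finset.mul_prod_erase _ _ (Finset.mem_univ t)]
  rw [Finset.prod_congr rfl (g := fun t' => φ t' fun w => y (Sum.inl (t', w)))]
  · simp only [Function.update_self, hc, Pi.smul_apply, smul_eq_mul]
    have : y ∘ ⇑(blockEmb (E := E) t) = fun w => y (Sum.inl (t, w)) := rfl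
    rw [this]
    ring
  · intro t' ht'
    rw [Function.update_of_ne (Finset.ne_of_mem_erase ht')]

theorem extra_apply_prodState (g : Gate E) (φ : T → StateVec W) (χ : StateVec E) :
    (g.map extraEmb).apply (prodState φ χ) = prodState φ (g.apply χ) := by
  ext y
  rw [Gate.map_apply]
  have h1 : (fun v => prodState φ χ
      (Function.extend (extraEmb : E ↪ (T × W) ⊕ E) v y))
        = (∏ t, φ t fun w => y (Sum.inl (t, w))) • χ := by
    ext v
    have h2 : ∀ p, Function.extend (extraEmb : E ↪ (T × W) ⊕ E) v y
        (Sum.inl p) = y (Sum.inl p) := by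
      intro p
      rw [Function.extend_apply']
      simp
    have h3 : ∀ p, Function.extend (extraEmb : E ↪ (T × W) ⊕ E) v y
        (Sum.inr p) = v p := fun p =>
      (extraEmb : E ↪ (T × W) ⊕ E).injective.extend_apply v y p
    simp only [prodState, h2, h3, Pi.smul_apply, smul_eq_mul]
  rw [h1, Gate.apply_smul]
  rfl

theorem runGates_map_block (t : T) (gs : List (Gate W)) (φ : T → StateVec W) (χ : StateVec E) :
    runGates (gs.map (Gate.map (blockEmb t))) (prodState φ χ)
      = prodState (Function.update φ t (runGates gs (φ t))) χ := by
  induction gs generalizing φ with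
  | nil => simp
  | cons g gs ih => simp [block_apply_prodState, ih]

/-- One layer which runs the given gates on every block. -/
noncomputable def parLayer (E : Type*) (G : T → List (Gate W)) : List (Gate ((T × W) ⊕ E)) :=
  Finset.univ.toList.flatMap fun t => (G t).map (Gate.map (blockEmb t))

theorem runGates_parLayer (G : T → List (Gate W)) (φ : T → StateVec W) (χ : StateVec E) :
    runGates (parLayer E G) (prodState φ χ) = prodState (fun t => runGates (G t) (φ t)) χ := by
  have key : ∀ (l : List T), l.Nodup → ∀ φ : T → StateVec W,
      runGates (l.flatMap fun t => (G t).map (Gate.map (blockEmb (E := E) t))) (prodState φ χ)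
        = prodState (fun t => if t ∈ l then runGates (G t) (φ t) else φ t) χ := by
    intro l
    induction l with
    | nil => intro _ φ; simp
    | cons t l ih =>
      intro hl φ
      rw [List.nodup_cons] at hl
      rw [List.flatMap_cons, runGates_append, runGates_map_block, ih hl.2]
      congr 1
      ext1 t'
      by_cases h : t' = t
      · subst h; simp [hl.1]
      · simp [h]
  rw [parLayer, key _ (Finset.nodup_toList _)]
  simp

theorem DisjointGates.parLayer {G : T → List (Gate W)} (hG : ∀ t, DisjointGates (G t)) :
    DisjointGates (parLayer E G) := by
  unfold DisjointGates QAC.parLayer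
  rw [List.pairwise_flatMap]
  refine ⟨fun t _ => (hG t).map _, ?_⟩
  refine (Finset.nodup_toList _).imp fun {t t'} hne g hg g' hg' => ?_
  obtain ⟨h, -, rfl⟩ := List.mem_map.1 hg
  obtain ⟨h', -, rfl⟩ := List.mem_map.1 hg'
  rw [Gate.support_map, Gate.support_map, Finset.disjoint_left]
  intro q hq hq'
  obtain ⟨w, -, rfl⟩ := Finset.mem_map.1 hq
  obtain ⟨w', -, hw'⟩ := Finset.mem_map.1 hq'
  rw [blockEmb_apply, blockEmb_apply, Sum.inl.injEq, Prod.mk.injEq] at hw'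
  exact hne hw'.1.symm

/-- Run a family of layered circuits with `d` layers each in parallel, one on every block. -/
noncomputable def parLayers (E : Type*) (d : ℕ) (L : T → List (List (Gate W))) :
    List (List (Gate ((T × W) ⊕ E))) :=
  -- A block with fewer than `d` layers idles in the missing ones.
  (List.range d).map fun l => parLayer E fun t => (L t).getD l []

theorem runGates_parLayers {d : ℕ} {L : T → List (List (Gate W))} (hL : ∀ t, (L t).length = d)
    (φ : T → StateVec W) (χ : StateVec E) :
    runGates (parLayers E d L).flatten (prodState φ χ)
      = prodState (fun t => runGates (L t).flatten (φ t)) χ := by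
  have key : ∀ k, runGates (parLayers E k L).flatten (prodState φ χ)
      = prodState (fun t => runGates (((List.range k).map fun l => (L t).getD l []).flatten) (φ t))
        χ := by
    intro k
    induction k with
    | zero => simp [parLayers]
    | succ k ih =>
      have : (parLayers E (k + 1) L).flatten
          = (parLayers E k L).flatten ++ parLayer E fun t => (L t).getD k [] := by
        simp [parLayers, List.range_succ]
      rw [this, runGates_append, ih, runGates_parLayer]
      simp [List.range_succ]
  rw [key]
  congr 1
  ext1 t
  congr 2
  apply List.ext_getElem
  · simp [hL]
  · intro i h1 h2
    simp [h2]

theorem disjoint_parLayers {d : ℕ} {L : T → List (List (Gate W))}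
    (hL : ∀ t, ∀ l ∈ L t, DisjointGates l) : ∀ l ∈ parLayers E d L, DisjointGates l := by
  intro l hl
  obtain ⟨i, -, rfl⟩ := List.mem_map.1 hl
  refine DisjointGates.parLayer fun t => ?_
  by_cases h : i < (L t).length
  · rw [List.getD_eq_getElem _ _ h]
    exact hL t _ (List.getElem_mem h)
  · rw [List.getD_eq_default _ _ (not_lt.1 h)]
    exact List.Pairwise.nil

theorem basisState_eq_prodState [Fintype W] [Fintype E] (z : (T × W) ⊕ E → Bool) :
    basisState z = prodState (fun t => basisState fun w => z (Sum.inl (t, w)))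
      (basisState fun e => z (Sum.inr e)) := by
  ext y
  simp only [basisState, prodState]
  rw [Fintype.prod_boole, ite_zero_mul_ite_zero, mul_one]
  refine if_congr ?_ rfl rfl
  constructor
  · rintro rfl; simp
  · rintro ⟨h1, h2⟩
    ext (⟨t, w⟩ | e)
    · exact congrFun (h1 t) w
    · exact congrFun h2 e

end Parallel

end QAC

namespace QAC

variable {Q W T E : Type*}

/-! ### The NAND of the flags of independent blocks. -/

section Nand

variable [DecidableEq T] [DecidableEq W] [Fintype T] [Fintype W]

/-- The Pauli `X` gate. -/
noncomputable def pauliX : Matrix.unitaryGroup Bool ℂ :=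
  ⟨Matrix.of fun a b => if a = b then 0 else 1, by
    rw [Matrix.mem_unitaryGroup_iff]
    ext a b
    cases a <;> cases b <;> simp [Matrix.mul_apply, Matrix.star_apply]⟩

theorem pauliX_apply [DecidableEq Q] (q : Q) (ψ : StateVec Q) :
    (Gate.single q pauliX).apply ψ = fun y => ψ (Function.update y q (!(y q))) := by
  ext y
  cases h : y q <;> simp [Gate.apply, pauliX, h]

/-- The copy of a fixed qubit in every block. -/
def flagEmb (E : Type*) (q : W) : T ↪ (T × W) ⊕ E :=
  ⟨fun t => Sum.inl (t, q), fun a b h => by simpa using h⟩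

@[simp] theorem flagEmb_apply (q : W) (t : T) : flagEmb E q t = Sum.inl (t, q) := rfl

/-- Run the layered circuits `L t` in parallel and write the negated conjunction of the
qubits `q` of all the blocks to the extra qubit. -/
noncomputable def nandLayers [Nonempty T] (d : ℕ) (L : T → List (List (Gate W))) (q : W) :
    List (List (Gate ((T × W) ⊕ Unit))) :=
  parLayers Unit d L ++
    -- The extra qubit is raised to 1 first, so the Toffoli gate lowers it to 0 exactly when all
    -- flags are 1.
    [[.single (Sum.inr ()) pauliX],
      [.toffoli (Finset.univ.map (flagEmb Unit q)) (Sum.inr ()) (Finset.univ_nonempty.map) (by simp)]]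

theorem nandLayers_length [Nonempty T] (d : ℕ) (L : T → List (List (Gate W))) (q : W) :
    (nandLayers d L q).length = d + 2 := by
  simp [nandLayers, parLayers]

theorem disjoint_nandLayers [Nonempty T] {d : ℕ} {L : T → List (List (Gate W))} (q : W)
    (hL : ∀ t, ∀ l ∈ L t, DisjointGates l) : ∀ l ∈ nandLayers d L q, DisjointGates l := by
  intro l hl
  rw [nandLayers, List.mem_append] at hl
  rcases hl with hl | hl
  · exact disjoint_parLayers hL l hl
  · simp only [List.mem_cons, List.not_mem_nil, or_false] at hl
    rcases hl with rfl | rfl <;> exact List.pairwise_singleton _ _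

/-- The bit string made of the strings of all blocks and an extra bit. -/
def joinBits (y : T → W → Bool) (b : Bool) : (T × W) ⊕ Unit → Bool :=
  Sum.elim (fun p => y p.1 p.2) fun _ => b

theorem sum_joinBits (F : ((T × W) ⊕ Unit → Bool) → ℝ) :
    ∑ y, F y = ∑ y : T → W → Bool, (F (joinBits y true) + F (joinBits y false)) := by
  let e : (T → W → Bool) × (Unit → Bool) ≃ ((T × W) ⊕ Unit → Bool) :=
    ((Equiv.curry T W Bool).symm.prodCongr (Equiv.refl _)).trans
      (Equiv.sumArrowEquivProdArrow _ _ _).symm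
  rw [← Equiv.sum_comp e, Fintype.sum_prod_type]
  refine Finset.sum_congr rfl fun y _ => ?_
  rw [← Equiv.sum_comp (Equiv.funUnique Unit Bool).symm, Fintype.sum_bool]
  rfl

/-- The extra qubit reads 0 exactly when all flags read 1; the blocks are in a product state, so
this probability factors. -/
theorem measureProb_nandLayers [Nonempty T] {d : ℕ} {L : T → List (List (Gate W))} (q : W)
    (hL : ∀ t, (L t).length = d) (z : (T × W) ⊕ Unit → Bool) (hz : z (Sum.inr ()) = false) :
    measureProb (runGates (nandLayers d L q).flatten (basisState z)) (Sum.inr ()) true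
      = 1 - ∏ t, measureProb (runGates (L t).flatten
          (basisState fun w => z (Sum.inl (t, w)))) q true := by
  rw [measureProb_true_runGates]
  congr 1
  rw [nandLayers, List.flatten_append, runGates_append, basisState_eq_prodState,
    runGates_parLayers hL]
  set φ : T → StateVec W := fun t => runGates (L t).flatten
    (basisState fun w => z (Sum.inl (t, w))) with hφ
  simp only [List.flatten_cons, List.flatten_nil, List.append_nil, List.singleton_append,
    runGates_cons, runGates_nil, pauliX_apply]
  unfold measureProb
  rw [Finset.prod_univ_sum, Fintype.piFinset_univ]
  rw [sum_joinBits]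
  refine Finset.sum_congr rfl fun y _ => ?_
  have hb : ∀ b : Bool, (fun _ : Unit => b) = (fun e => z (Sum.inr e)) ↔ b = false := by
    intro b
    constructor
    · intro h; rw [congrFun h (), hz]
    · rintro rfl; ext; exact hz.symm
  have hi : ∀ c d e t, (fun w => Function.update (Function.update
      (joinBits y e) (Sum.inr ()) c) (Sum.inr ()) d (Sum.inl (t, w))) = y t := by
    intro c d e t
    funext w
    rw [Function.update_of_ne Sum.inl_ne_inr, Function.update_of_ne Sum.inl_ne_inr]
    rfl
  have hl : ∀ e t w, joinBits y e (Sum.inl (t, w)) = y t w := fun e t w => rfl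
  have hr : ∀ e, joinBits y e (Sum.inr ()) = e := fun e => rfl
  simp only [Gate.apply, prodState, hi, basisState, hb, hr, hl, Function.update_self,
    Finset.forall_mem_map, Finset.mem_univ, true_implies, flagEmb_apply]
  by_cases h : ∀ t, y t q = true
  · simp [h, norm_prod, Finset.prod_pow, hφ]
  · obtain ⟨t, ht⟩ := not_forall.1 h
    refine Eq.trans ?_ (Finset.prod_eq_zero (Finset.mem_univ t) (if_neg ht)).symm
    simp [h]

end Nand

/-! ### Passing from an arbitrary finite register to the standard one. -/

section Relabel

theorem runGates_map_equiv [DecidableEq Q] [DecidableEq W] (e : W ≃ Q) (gs : List (Gate W))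
    (ψ : StateVec Q) :
    runGates (gs.map (Gate.map e.toEmbedding)) ψ
      = fun y => runGates gs (fun w => ψ (w ∘ e.symm)) (y ∘ e) := by
  induction gs generalizing ψ with
  | nil =>
    ext y
    simp [Function.comp_assoc]
  | cons g gs ih =>
    rw [List.map_cons, runGates_cons, ih]
    ext y
    rw [runGates_cons]
    congr 1
    ext w
    rw [Gate.map_apply]
    have h1 : (w ∘ e.symm) ∘ ⇑e.toEmbedding = w := by
      ext; simp
    rw [h1]
    congr 1
    ext v
    congr 1
    ext p
    obtain ⟨a, rfl⟩ := e.surjective p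
    refine (e.toEmbedding.injective.extend_apply v (w ∘ e.symm) a).trans ?_
    simp

theorem measureProb_map_equiv [Fintype Q] [Fintype W] [DecidableEq Q] [DecidableEq W] (e : W ≃ Q)
    (gs : List (Gate W)) (z : Q → Bool) (o : W) (b : Bool) :
    measureProb (runGates (gs.map (Gate.map e.toEmbedding)) (basisState z)) (e o) b
      = measureProb (runGates gs (basisState (z ∘ e))) o b := by
  rw [runGates_map_equiv]
  have h1 : (fun w => (basisState z : StateVec Q) (w ∘ e.symm)) = basisState (z ∘ e) := by
    ext w
    unfold basisState
    congr 1
    rw [eq_iff_iff]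
    exact Equiv.comp_symm_eq e z w
  rw [h1]
  unfold measureProb
  rw [← Equiv.sum_comp (Equiv.arrowCongr e (Equiv.refl Bool))]
  refine Finset.sum_congr rfl fun y _ => ?_
  have h2 : (Equiv.arrowCongr e (Equiv.refl Bool)) y ∘ e = y := by
    ext; simp
  have h3 : (Equiv.arrowCongr e (Equiv.refl Bool)) y (e o) = y o := by simp
  beta_reduce
  rw [h2, h3]

/-- Every finite register with distinguished input qubits and a distinguished output qubit can be
relabelled to have the standard form. -/
theorem exists_register_equiv {ι : Type*} [Fintype W] [DecidableEq W] (inp : ι → W)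
    (hinp : Function.Injective inp) (o : W) (ho : ∀ i, inp i ≠ o) :
    ∃ (a : ℕ) (e : W ≃ Register ι a), (∀ i, e (inp i) = Sum.inl i) ∧ e o = outputQubit := by
  classical
  let R := {q : W // (∀ i, inp i ≠ q) ∧ q ≠ o}
  let F : Register ι (Fintype.card R) → W :=
    Sum.elim inp (Sum.elim (fun j => ((Fintype.equivFin R).symm j : W)) fun _ => o)
  have hF : Function.Bijective F := by
    constructor
    · rintro (i | j | ⟨⟩) (i' | j' | ⟨⟩) h <;> simp only [F, Sum.elim_inl, Sum.elim_inr] at h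
      · rw [hinp h]
      · exact absurd h (((Fintype.equivFin R).symm j').2.1 i)
      · exact absurd h (ho i)
      · exact absurd h.symm (((Fintype.equivFin R).symm j).2.1 i')
      · rw [(Fintype.equivFin R).symm.injective (Subtype.ext h)]
      · exact absurd h ((Fintype.equivFin R).symm j).2.2
      · exact absurd h.symm (ho i')
      · exact absurd h.symm ((Fintype.equivFin R).symm j').2.2
      · rfl
    · intro q
      by_cases hi : ∃ i, inp i = q
      · obtain ⟨i, rfl⟩ := hi
        exact ⟨Sum.inl i, rfl⟩
      · by_cases hq : q = o
        · exact ⟨Sum.inr (Sum.inr ()), hq.symm⟩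
        · exact ⟨Sum.inr (Sum.inl (Fintype.equivFin R ⟨q, not_exists.1 hi, hq⟩)), by simp [F]⟩
  refine ⟨_, (Equiv.ofBijective F hF).symm, fun i => ?_, ?_⟩
  · rw [Equiv.symm_apply_eq]; rfl
  · rw [Equiv.symm_apply_eq]; rfl

/-- A layered circuit on any finite register gives a circuit on the standard register with the same
depth and the same output probabilities. -/
theorem exists_circuit_of_layers {ι : Type*} [Fintype ι] [DecidableEq ι] [Fintype W]
    [DecidableEq W] (inp : ι → W) (hinp : Function.Injective inp) (o : W) (ho : ∀ i, inp i ≠ o)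
    (Ls : List (List (Gate W))) (hLs : ∀ l ∈ Ls, DisjointGates l) :
    ∃ (a : ℕ) (C : Circuit (Register ι a)), C.depth = Ls.length ∧
      C.size ≤ (Ls.length + 1) * Fintype.card W ∧
      ∀ (z : ι → Bool) (zW : W → Bool), (∀ i, zW (inp i) = z i) →
        (∀ q, (∀ i, inp i ≠ q) → zW q = false) → ∀ b,
          C.outputProb z b = measureProb (runGates Ls.flatten (basisState zW)) o b := by
  obtain ⟨a, e, he, heo⟩ := exists_register_equiv inp hinp o ho
  refine ⟨a, ⟨Ls.map (List.map (Gate.map e.toEmbedding)), ?_⟩, ?_, ?_, ?_⟩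
  · intro l hl
    obtain ⟨l', hl', rfl⟩ := List.mem_map.1 hl
    exact (hLs l' hl').map _
  · simp [Circuit.depth]
  · have hcard : Fintype.card (Register ι a) = Fintype.card W := (Fintype.card_congr e).symm
    have : ((Ls.map (List.map (Gate.map e.toEmbedding))).map List.length).sum
        ≤ Ls.length * Fintype.card W := by
      refine (List.sum_le_card_nsmul _ (Fintype.card W) ?_).trans (by simp)
      intro k hk
      simp only [List.map_map, List.mem_map, Function.comp_apply, List.length_map] at hk
      obtain ⟨l, hl, rfl⟩ := hk
      exact (hLs l hl).length_le
    unfold Circuit.size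
    rw [hcard]
    linarith
  · intro z zW h1 h2 b
    have hz : (Sum.elim z fun _ => false) ∘ e = zW := by
      ext q
      by_cases hi : ∃ i, inp i = q
      · obtain ⟨i, rfl⟩ := hi
        simp [he, h1]
      · rw [h2 q (not_exists.1 hi)]
        cases hq : e q with
        | inl i =>
          rw [← he i] at hq
          exact absurd ⟨i, (e.injective hq).symm⟩ hi
        | inr j => simp [hq]
    have := measureProb_map_equiv e Ls.flatten (Sum.elim z fun _ => false) o b
    rw [hz, heo, List.map_flatten] at this
    exact this

end Relabel

end QAC

namespace QAC

variable {Q W T E : Type*}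

/-! ### One control qubit and one work qubit. -/

section PairStates

/-- The state `|b⟩ ⊗ v` of a control qubit `false` and a target qubit `true`. -/
def pairState (b : Bool) (v : Bool → ℂ) : StateVec Bool :=
  fun y => if y false = b then v (y true) else 0

/-- The controlled-not gate from the control qubit to the target qubit. -/
def pairCNot : Gate Bool := .toffoli {false} true (by simp) (by simp)

theorem basisState_bool (z : Bool → Bool) :
    basisState z = pairState (z false) (Pi.single (z true) 1) := by
  ext y
  have : y = z ↔ y false = z false ∧ y true = z true := by
    rw [funext_iff, Bool.forall_bool]
  simp only [basisState, pairState, this, Pi.single_apply, ite_and]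

theorem single_target_pairState (U : Matrix.unitaryGroup Bool ℂ) (b : Bool) (v : Bool → ℂ) :
    (Gate.single true U).apply (pairState b v)
      = pairState b ((U : Matrix Bool Bool ℂ).mulVec v) := by
  ext y
  by_cases h : y false = b <;> simp [Gate.apply, pairState, Matrix.mulVec, dotProduct, h]

theorem single_control_pairState (b : Bool) (v : Bool → ℂ) :
    (Gate.single false pauliX).apply (pairState b v) = pairState (!b) v := by
  rw [pauliX_apply]
  ext y
  cases b <;> cases h : y false <;> simp [pairState, h]

theorem cnot_pairState (b : Bool) (v : Bool → ℂ) :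
    pairCNot.apply (pairState b v) = pairState b fun c => v (xor c b) := by
  ext y
  by_cases h : y false = b
  · cases b <;> simp [pairCNot, Gate.apply, pairState, h]
  · simp [pairCNot, Gate.apply, pairState, h]

/-- The action of `U Xᵇ U⁻¹` on the state of a single qubit. -/
noncomputable def conjX (U : Matrix.unitaryGroup Bool ℂ) (b : Bool) (v : Bool → ℂ) : Bool → ℂ :=
  (U : Matrix Bool Bool ℂ).mulVec
    fun c => ((U⁻¹ : Matrix.unitaryGroup Bool ℂ) : Matrix Bool Bool ℂ).mulVec v (xor c b)

/-- A conjugate of the involution Xᵇ is an involution, so the preparation is uncomputed by repeating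
it. -/
theorem conjX_conjX (U : Matrix.unitaryGroup Bool ℂ) (b : Bool) (v : Bool → ℂ) :
    conjX U b (conjX U b v) = v := by
  unfold conjX
  simp only [Matrix.mulVec_mulVec, ← Matrix.UnitaryGroup.mul_val, inv_mul_cancel,
    Matrix.UnitaryGroup.one_val, Matrix.one_mulVec, Bool.xor_assoc, bne_self_eq_false,
    Bool.xor_false, mul_inv_cancel]

/-- The rotation by the angle `t`. -/
noncomputable def rotation (t : ℝ) : Matrix.unitaryGroup Bool ℂ :=
  ⟨Matrix.of fun a b => if a = b then (Real.cos t : ℂ) else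
      if a then (Real.sin t : ℂ) else -(Real.sin t : ℂ), by
    have h : ((Real.cos t : ℝ) : ℂ) * (Real.cos t : ℝ) + ((Real.sin t : ℝ) : ℂ) * (Real.sin t : ℝ)
        = 1 := by
      exact_mod_cast (by nlinarith [Real.sin_sq_add_cos_sq t])
    rw [Matrix.mem_unitaryGroup_iff]
    ext a b
    cases a <;> cases b <;>
      simp only [Matrix.mul_apply, Matrix.star_apply, Fintype.sum_bool, Matrix.of_apply,
        Matrix.one_apply, Complex.star_def, map_neg, Complex.conj_ofReal, if_true, if_false,
        Bool.true_eq_false, Bool.false_eq_true]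
    · linear_combination h
    · ring
    · ring
    · linear_combination h⟩

theorem rotation_apply (t : ℝ) (a b : Bool) : (rotation t : Matrix Bool Bool ℂ) a b
    = if a = b then (Real.cos t : ℂ) else
      if a then (Real.sin t : ℂ) else -(Real.sin t : ℂ) := rfl

/-- The damping factor: a bit 1 multiplies the amplitude of |1⟩ by sin 2t, which can be any number
in [0, 1], and a bit 0 leaves it alone. -/
theorem conjX_rotation (t : ℝ) (b : Bool) :
    conjX (rotation t) b (Pi.single true 1) true = if b then (Real.sin (2 * t) : ℂ) else 1 := by
  have h : ((Real.cos t : ℝ) : ℂ) * (Real.cos t : ℝ) + ((Real.sin t : ℝ) : ℂ) * (Real.sin t : ℝ)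
      = 1 := by
    exact_mod_cast (by nlinarith [Real.sin_sq_add_cos_sq t])
  have h1 : (Pi.single true 1 : Bool → ℂ) true = 1 := rfl
  have h0 : (Pi.single true 1 : Bool → ℂ) false = 0 := rfl
  unfold conjX
  cases b <;>
    simp only [h1, h0, Matrix.UnitaryGroup.inv_val, Matrix.mulVec, dotProduct,
      Fintype.sum_bool, Matrix.star_apply, rotation_apply, Complex.star_def,
      Complex.conj_ofReal, if_true, if_false, Bool.true_eq_false, Bool.false_eq_true,
      Bool.xor_false, Bool.xor_true, Bool.not_true, Bool.not_false, Real.sin_two_mul,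
      map_neg]
  · linear_combination h
  · push_cast; ring

end PairStates

/-! ### The interference test on a single copy. -/

section Test

variable [DecidableEq T] [Fintype T] [Nonempty T]

/-- A test on a family of pairs of a control qubit `false` and a work qubit `true`, with an extra
work qubit `false` and a flag `true`. It applies `U X U⁻¹` controlled on the (possibly flipped)
control qubits to the all-ones string, marks the all-ones string in the extra qubit, uncomputes, and
sets the flag unless the work qubits are found in the all-ones state. -/
noncomputable def testLayers (U : Matrix.unitaryGroup Bool ℂ) (S : T → Bool) :
    List (List (Gate ((T × Bool) ⊕ Bool))) :=
  -- The preparation of |1⟩ is merged with the `U⁻¹` that opens `conjX`.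
  [parLayer Bool fun t => .single true (U⁻¹ * pauliX) ::
      if S t then [.single false pauliX] else [],
    parLayer Bool fun _ => [pairCNot],
    parLayer Bool fun _ => [.single true U],
    [.toffoli (Finset.univ.map (flagEmb Bool true)) (Sum.inr false)
      Finset.univ_nonempty.map (by simp)],
    parLayer Bool fun _ => [.single true U⁻¹],
    parLayer Bool fun _ => [pairCNot],
    parLayer Bool fun _ => [.single true U],
    -- This rotation makes the new amplitude of |1⟩ equal to the old amplitude of |1⟩ minus that of
    -- |0⟩, over √2. The flag is raised here and lowered by the last gate on rejection.
    [(Gate.single false (rotation (-(Real.pi / 4)))).map extraEmb,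
      (Gate.single true pauliX).map extraEmb],
    [.toffoli (insert (Sum.inr false) (Finset.univ.map (flagEmb Bool true))) (Sum.inr true)
      (Finset.insert_nonempty _ _) (by simp)]]

theorem disjoint_testLayers (U : Matrix.unitaryGroup Bool ℂ) (S : T → Bool) :
    ∀ l ∈ testLayers U S, DisjointGates l := by
  intro l hl
  simp only [testLayers, List.mem_cons, List.not_mem_nil, or_false] at hl
  rcases hl with rfl | rfl | rfl | rfl | rfl | rfl | rfl | rfl | rfl
  · refine DisjointGates.parLayer fun t => ?_
    split_ifs
    · simp [DisjointGates, Gate.support]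
    · exact List.pairwise_singleton _ _
  all_goals first
    | exact DisjointGates.parLayer fun t => List.pairwise_singleton _ _
    | exact List.pairwise_singleton _ _
    | simp [DisjointGates, Gate.support, Gate.map]

theorem extra_run (a : Bool) :
    runGates [.single false (rotation (-(Real.pi / 4))), .single true pauliX]
      (pairState a (Pi.single false 1)) = fun y => if y true = true then
        (rotation (-(Real.pi / 4)) : Matrix Bool Bool ℂ) (y false) a else 0 := by
  rw [runGates_cons, runGates_cons, runGates_nil, pauliX_apply]
  ext y
  cases a <;> cases h : y true <;> simp [Gate.apply, pairState]

/-- The gate only moves the all-ones component from |0⟩ to |1⟩ in the extra qubit. Written as a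
correction term, the result is a combination of product states, to which `uncompute_run` applies
termwise. -/
theorem mark_ones (b : T → Bool) (u : T → Bool → ℂ) :
    (Gate.toffoli (Finset.univ.map (flagEmb Bool true)) (Sum.inr false)
      Finset.univ_nonempty.map (by simp)).apply
        (prodState (fun t => pairState (b t) (u t)) (pairState false (Pi.single false 1)))
      = prodState (fun t => pairState (b t) (u t)) (pairState false (Pi.single false 1))
        + (∏ t, u t true) • (prodState (fun t => pairState (b t) (Pi.single true 1))
            (pairState true (Pi.single false 1))
          + (-1 : ℂ) • prodState (fun t => pairState (b t) (Pi.single true 1))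
            (pairState false (Pi.single false 1))) := by
  ext y
  have hi : ∀ c p, Function.update y (Sum.inr false) c (Sum.inl p) = y (Sum.inl p) := by
    intro c p
    rw [Function.update_of_ne Sum.inl_ne_inr]
  simp only [Gate.apply, prodState, hi, Pi.add_apply, Pi.smul_apply, smul_eq_mul,
    Finset.forall_mem_map, Finset.mem_univ, true_implies, flagEmb_apply, pairState,
    Function.update_self]
  by_cases h : ∀ t, y (Sum.inl (t, true)) = true
  · have hP : ∏ t, (if y (Sum.inl (t, false)) = b t then u t (y (Sum.inl (t, true))) else 0)
        = (∏ t, u t true) * ∏ t, if y (Sum.inl (t, false)) = b t then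
          (Pi.single true 1 : Bool → ℂ) (y (Sum.inl (t, true))) else 0 := by
      rw [← Finset.prod_mul_distrib]
      refine Finset.prod_congr rfl fun t _ => ?_
      rw [h t]
      split_ifs <;> simp
    rw [hP]
    generalize (∏ t, if y (Sum.inl (t, false)) = b t then
      (Pi.single true 1 : Bool → ℂ) (y (Sum.inl (t, true))) else 0) = P
    cases hy : y (Sum.inr false) <;> simp [h] <;> ring
  · obtain ⟨t, ht⟩ := not_forall.1 h
    have hP : (∏ t, if y (Sum.inl (t, false)) = b t then
          (Pi.single true 1 : Bool → ℂ) (y (Sum.inl (t, true))) else 0) = 0 := by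
      refine Finset.prod_eq_zero (Finset.mem_univ t) ?_
      rw [Bool.not_eq_true] at ht
      simp [ht]
    rw [hP]
    simp [h]

theorem uncompute_run (U : Matrix.unitaryGroup Bool ℂ) (b : T → Bool) (u : T → Bool → ℂ)
    (a : Bool) :
    runGates (parLayer Bool (fun _ : T => [.single true U⁻¹]) ++ parLayer Bool (fun _ => [pairCNot])
        ++ parLayer Bool (fun _ => [.single true U])
        ++ [(Gate.single false (rotation (-(Real.pi / 4)))).map extraEmb,
          (Gate.single true pauliX).map extraEmb])
        (prodState (fun t => pairState (b t) (u t)) (pairState a (Pi.single false 1)))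
      = prodState (fun t => pairState (b t) (conjX U (b t) (u t))) fun y => if y true = true then
        (rotation (-(Real.pi / 4)) : Matrix Bool Bool ℂ) (y false) a else 0 := by
  have h := extra_run a
  simp only [runGates_cons, runGates_nil] at h
  simp only [runGates_append, runGates_parLayer, runGates_cons, runGates_nil, extra_apply_prodState,
    h, single_target_pairState, cnot_pairState]
  rfl

theorem prepare_run (U : Matrix.unitaryGroup Bool ℂ) (S : T → Bool) (z : (T × Bool) ⊕ Bool → Bool)
    (b : T → Bool) (hb : ∀ t, xor (z (Sum.inl (t, false))) (S t) = b t)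
    (hz : ∀ t, z (Sum.inl (t, true)) = false) (hg : ∀ e, z (Sum.inr e) = false) :
    runGates (parLayer Bool (fun t => .single true (U⁻¹ * pauliX) ::
          if S t then [.single false pauliX] else []) ++
        parLayer Bool (fun _ => [pairCNot]) ++ parLayer Bool (fun _ => [.single true U]))
        (basisState z)
      = prodState (fun t => pairState (b t)
          (conjX U (b t) (Pi.single true 1)))
          (pairState false (Pi.single false 1)) := by
  have hX : (pauliX : Matrix Bool Bool ℂ).mulVec (Pi.single false 1) = Pi.single true 1 := by
    ext b
    cases b <;> simp [Matrix.mulVec, dotProduct, pauliX]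
  have h1 : ∀ t, runGates (.single true (U⁻¹ * pauliX) ::
      if S t then [.single false pauliX] else [])
        (pairState (z (Sum.inl (t, false))) (Pi.single false 1))
      = pairState (b t)
        (((U⁻¹ : Matrix.unitaryGroup Bool ℂ) : Matrix Bool Bool ℂ).mulVec (Pi.single true 1)) := by
    intro t
    rw [runGates_cons, single_target_pairState, Matrix.UnitaryGroup.mul_val, ← Matrix.mulVec_mulVec,
      hX]
    rw [← hb]
    cases S t <;> simp [single_control_pairState]
  rw [basisState_eq_prodState]
  simp only [basisState_bool, hz, hg, runGates_append, runGates_parLayer, h1]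
  simp only [runGates_cons, runGates_nil, single_target_pairState, cnot_pairState]
  rfl

/-- Uncomputing returns the unmarked term to all-ones with amplitude 1. The correction has
coefficient c and again overlap c with all-ones, so the extra qubit there is (1 - c²)|0⟩ + c²|1⟩
before its rotation. A lowered flag forces every other qubit, so one basis string remains. -/
theorem testLayers_run (U : Matrix.unitaryGroup Bool ℂ) (S : T → Bool)
    (z : (T × Bool) ⊕ Bool → Bool)
    (b : T → Bool) (hb : ∀ t, xor (z (Sum.inl (t, false))) (S t) = b t)
    (hz : ∀ t, z (Sum.inl (t, true)) = false) (hg : ∀ e, z (Sum.inr e) = false)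
    (y : (T × Bool) ⊕ Bool → Bool) (hy : y (Sum.inr true) = false) :
    runGates (testLayers U S).flatten (basisState z) y
      = if y = (Sum.elim (fun p => p.2 || b p.1) fun e => !e) then
          (Real.sqrt 2 / 2 : ℝ) * (2 * (∏ t, conjX U (b t)
            (Pi.single true 1) true) ^ 2 - 1) else 0 := by
  set c : ℂ := ∏ t, conjX U (b t) (Pi.single true 1) true with hc
  have hflat : (testLayers U S).flatten
      = (parLayer Bool (fun t => .single true (U⁻¹ * pauliX) ::
          if S t then [.single false pauliX] else []) ++
        parLayer Bool (fun _ => [pairCNot]) ++ parLayer Bool (fun _ => [.single true U])) ++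
      ([.toffoli (Finset.univ.map (flagEmb Bool true)) (Sum.inr false)
        Finset.univ_nonempty.map (by simp)] ++
      ((parLayer Bool (fun _ : T => [.single true U⁻¹]) ++ parLayer Bool (fun _ => [pairCNot])
        ++ parLayer Bool (fun _ => [.single true U])
        ++ [(Gate.single false (rotation (-(Real.pi / 4)))).map extraEmb,
          (Gate.single true pauliX).map extraEmb]) ++
      [.toffoli (insert (Sum.inr false) (Finset.univ.map (flagEmb Bool true))) (Sum.inr true)
        (Finset.insert_nonempty _ _) (by simp)])) := by
    simp [testLayers]
  rw [hflat, runGates_append, prepare_run U S z b hb hz hg, runGates_append, runGates_cons,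
    runGates_nil, mark_ones, runGates_append]
  simp only [runGates_add, runGates_smul, uncompute_run, conjX_conjX]
  have hi : ∀ c p, Function.update y (Sum.inr true) c (Sum.inl p) = y (Sum.inl p) := by
    intro c p
    rw [Function.update_of_ne Sum.inl_ne_inr]
  have hf : ∀ c, Function.update y (Sum.inr true) c (Sum.inr false) = y (Sum.inr false) := by
    intro c
    rw [Function.update_of_ne (by simp)]
  simp only [runGates_cons, runGates_nil, Gate.apply, prodState, Pi.add_apply, Pi.smul_apply,
    smul_eq_mul, pairState, hi, hf, Function.update_self, hy, Bool.false_xor, decide_eq_true_eq,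
    Finset.forall_mem_insert, Finset.forall_mem_map, Finset.mem_univ, true_implies, flagEmb_apply]
  by_cases h : y (Sum.inr false) = true ∧ ∀ t, y (Sum.inl (t, true)) = true
  · simp only [if_pos h]
    by_cases hx : ∀ t, y (Sum.inl (t, false)) = b t
    · rw [if_pos]
      · simp only [hx, h, if_true, Pi.single_eq_same, Finset.prod_const_one, ← hc, rotation_apply]
        simp
        ring
      · ext (⟨t, _ | _⟩ | _ | _) <;> simp [h, hx, hy]
    · rw [if_neg]
      · obtain ⟨t, ht⟩ := not_forall.1 hx
        have : ∀ F : T → ℂ, (∏ t, if y (Sum.inl (t, false)) = b t then F t else 0) = 0 :=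
          fun F => Finset.prod_eq_zero (Finset.mem_univ t) (if_neg ht)
        simp only [this]
        ring
      · rintro rfl
        exact hx fun t => by simp
  · have hne : y ≠ Sum.elim (fun p => p.2 || b p.1) fun e => !e := by
      rintro rfl
      exact h (by simp)
    rw [if_neg hne]
    simp [h]

theorem measureProb_testLayers (U : Matrix.unitaryGroup Bool ℂ) (S : T → Bool)
    (z : (T × Bool) ⊕ Bool → Bool)
    (b : T → Bool) (hb : ∀ t, xor (z (Sum.inl (t, false))) (S t) = b t)
    (hz : ∀ t, z (Sum.inl (t, true)) = false) (hg : ∀ e, z (Sum.inr e) = false) :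
    measureProb (runGates (testLayers U S).flatten (basisState z)) (Sum.inr true) true
      = 1 - ‖2 * (∏ t, conjX U (b t)
            (Pi.single true 1) true) ^ 2 - 1‖ ^ 2 / 2 := by
  rw [measureProb_true_runGates]
  congr 1
  unfold measureProb
  rw [Finset.sum_congr rfl (g := fun y => if y = (Sum.elim
      (fun p => p.2 || b p.1) fun e => !e) then
        ‖2 * (∏ t, conjX U (b t)
            (Pi.single true 1) true) ^ 2 - 1‖ ^ 2 / 2 else 0)]
  · simp
  · intro y _
    by_cases hy : y (Sum.inr true) = false
    · rw [if_pos hy, testLayers_run U S z b hb hz hg y hy]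
      split_ifs
      · rw [norm_mul, mul_pow, Complex.norm_real, Real.norm_eq_abs, sq_abs, div_pow,
          Real.sq_sqrt zero_le_two]
        ring
      · simp
    · rw [if_neg hy, if_neg]
      rintro rfl
      exact hy rfl

end Test

end QAC

/-! ### Real estimates for soundness. -/

namespace QAC

theorem exp_neg_div_le_one_sub {q : ℝ} (hq : q < 1) : Real.exp (-(q / (1 - q))) ≤ 1 - q := by
  have h : 0 < 1 - q := by linarith
  rw [Real.exp_neg, inv_le_comm₀ (Real.exp_pos _) h]
  have := Real.add_one_le_exp (q / (1 - q))
  have e : q / (1 - q) + 1 = (1 - q)⁻¹ := by field_simp; ring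
  linarith

theorem sum_range_pow_succ_le {s : ℝ} (h0 : 0 ≤ s) (h1 : s < 1) (m : ℕ) :
    ∑ i ∈ Finset.range m, s ^ (i + 1) ≤ s / (1 - s) := by
  have h := geom_sum_eq h1.ne m
  simp_rw [pow_succ]
  rw [← Finset.sum_mul, h, div_mul_eq_mul_div, ← neg_div_neg_eq, neg_sub]
  have : 0 ≤ s ^ m := pow_nonneg h0 m
  apply div_le_div_of_nonneg_right _ (by linarith)
  nlinarith

/-- Two geometric tails, one on each side of `j`; the bound does not depend on `m`. -/
theorem sum_pow_dist_le {s : ℝ} (h0 : 0 ≤ s) (h1 : s < 1) (m j : ℕ) (hj : j < m) :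
    ∑ k ∈ Finset.range m, (if k = j then 0 else s ^ (Nat.dist k j)) ≤ 2 * (s / (1 - s)) := by
  have hsplit := Finset.sum_range_add_sum_Ico
    (fun k => if k = j then 0 else s ^ (Nat.dist k j)) (Nat.succ_le_of_lt hj)
  rw [← hsplit, Finset.sum_range_succ, if_pos rfl, add_zero, two_mul]
  refine add_le_add ?_ ?_
  · rw [← Finset.sum_range_reflect]
    refine le_trans (le_of_eq (Finset.sum_congr rfl fun i hi => ?_)) (sum_range_pow_succ_le h0 h1 j)
    have := Finset.mem_range.1 hi
    rw [if_neg (by omega), Nat.dist_eq_sub_of_le (by omega)]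
    congr 1
    omega
  · rw [Finset.sum_Ico_eq_sum_range]
    refine le_trans (le_of_eq (Finset.sum_congr rfl fun i hi => ?_))
      (sum_range_pow_succ_le h0 h1 (m - (j + 1)))
    rw [if_neg (by omega), Nat.dist_eq_sub_of_le_right (by omega)]
    congr 1
    omega

/-- A product of factors which approach `1` geometrically with the distance from `j`. -/
theorem exp_le_prod_one_sub {s : ℝ} (h0 : 0 ≤ s) (h1 : s < 1) {m : ℕ} (j : Fin m)
    (q : Fin m → ℝ) (hqj : q j = 0)
    (hq : ∀ k, k ≠ j → q k ≤ s ^ (Nat.dist k j)) :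
    Real.exp (-(2 * s / (1 - s) ^ 2)) ≤ ∏ k, (1 - q k) := by
  have hs : 0 < 1 - s := by linarith
  have key : ∀ k, q k / (1 - q k) ≤ (if (k : ℕ) = j then 0 else s ^ (Nat.dist k j)) / (1 - s) := by
    intro k
    split_ifs with h
    · rw [Fin.ext h, hqj]; simp
    · have hk := hq k fun h' => h (congrArg _ h')
      have hd : Nat.dist k j ≠ 0 := fun h' => h (Nat.eq_of_dist_eq_zero h')
      have : s ^ (Nat.dist k j) ≤ s := pow_le_of_le_one h0 h1.le hd
      gcongr
      linarith
  have hlt : ∀ k, q k < 1 := by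
    intro k
    by_cases h : k = j
    · rw [h, hqj]; exact one_pos
    · have hd : Nat.dist k j ≠ 0 := fun h' => h (Fin.ext (Nat.eq_of_dist_eq_zero h'))
      exact (hq k h).trans_lt ((pow_le_of_le_one h0 h1.le hd).trans_lt h1)
  calc Real.exp (-(2 * s / (1 - s) ^ 2)) ≤ Real.exp (∑ k, -(q k / (1 - q k))) := by
        apply Real.exp_le_exp.2
        rw [Finset.sum_neg_distrib, neg_le_neg_iff]
        refine (Finset.sum_le_sum fun k _ => key k).trans ?_
        rw [← Finset.sum_div,
          Fin.sum_univ_eq_sum_range (fun k => if k = (j : ℕ) then 0 else s ^ (Nat.dist k j)) m]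
        refine (div_le_div_of_nonneg_right (sum_pow_dist_le h0 h1 m j j.2) hs.le).trans ?_
        apply le_of_eq
        field_simp
    _ = ∏ k, Real.exp (-(q k / (1 - q k))) := Real.exp_sum _ _
    _ ≤ ∏ k, (1 - q k) := Finset.prod_le_prod (fun k _ => (Real.exp_pos _).le)
        fun k _ => exp_neg_div_le_one_sub (hlt k)

/-- The exponential decay rate of `1 - exp (-B sʳ)`, uniformly in `r ≥ 1`. -/
theorem exists_rate (B s : ℝ) (hB : 0 < B) (h0 : 0 < s) (h1 : s < 1) :
    ∃ c : ℝ, 0 < c ∧ ∀ r : ℕ, 1 ≤ r →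
      1 - Real.exp (-(B * (s ^ 2) ^ r)) ≤ (2 : ℝ) ^ (-(c * (r : ℝ))) := by
  have hlim : Filter.Tendsto (fun r : ℕ => B * s ^ r) Filter.atTop (nhds 0) := by
    simpa using (tendsto_pow_atTop_nhds_zero_of_lt_one h0.le h1).const_mul B
  obtain ⟨R, hR⟩ := Filter.eventually_atTop.1 (hlim.eventually (gt_mem_nhds one_pos))
  set δ : ℝ := 1 - Real.exp (-B) with hδ
  have hδ0 : 0 < δ := by
    have : Real.exp (-B) < Real.exp 0 := Real.exp_lt_exp.2 (by linarith)
    rw [Real.exp_zero] at this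
    linarith
  have hδ1 : δ < 1 := by have := Real.exp_pos (-B); linarith
  have hl2 : 0 < Real.log 2 := Real.log_pos one_lt_two
  have hls : Real.log s < 0 := Real.log_neg h0 h1
  have hlδ : Real.log δ < 0 := Real.log_neg hδ0 hδ1
  -- For r ≥ R one of the two factors s^r absorbs `B` and the other gives the rate `c1`. For the
  -- finitely many smaller r the bound `δ` < 1 suffices, and `c2` spreads it over R + 1 steps.
  set c1 := -Real.log s / Real.log 2 with hc1
  set c2 := -Real.log δ / Real.log 2 / (R + 1) with hc2
  have hc1' : 0 < c1 := div_pos (by linarith) hl2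
  have hc2' : 0 < c2 :=
    div_pos (div_pos (by linarith) hl2) (by positivity)
  have hpow : ∀ x : ℝ, (2 : ℝ) ^ x = Real.exp (Real.log 2 * x) := fun x =>
    Real.rpow_def_of_pos two_pos x
  refine ⟨min c1 c2, lt_min hc1' hc2', fun r hr => ?_⟩
  have hr0 : (0 : ℝ) ≤ r := Nat.cast_nonneg r
  by_cases h : R ≤ r
  · have hle : 1 - Real.exp (-(B * (s ^ 2) ^ r)) ≤ s ^ r := by
      have e1 := Real.add_one_le_exp (-(B * (s ^ 2) ^ r))
      have e2 : B * (s ^ 2) ^ r = (B * s ^ r) * s ^ r := by rw [← pow_mul, mul_comm 2, pow_mul]; ring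
      have e3 := hR r h
      have e4 : 0 ≤ s ^ r := by positivity
      nlinarith
    refine hle.trans ?_
    rw [hpow, ← Real.exp_log h0, ← Real.exp_nat_mul, Real.exp_le_exp]
    have : Real.log 2 * c1 = -Real.log s := by rw [hc1]; field_simp
    have hm : min c1 c2 * r * Real.log 2 ≤ c1 * r * Real.log 2 := by
      gcongr
      exact min_le_left _ _
    nlinarith
  · have hle : 1 - Real.exp (-(B * (s ^ 2) ^ r)) ≤ δ := by
      rw [hδ]
      have : (s ^ 2) ^ r ≤ 1 := pow_le_one₀ (by positivity) (by nlinarith)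
      gcongr
      nlinarith
    refine hle.trans ?_
    rw [hpow, ← Real.exp_log hδ0, Real.exp_le_exp]
    have : Real.log 2 * c2 * (R + 1) = -Real.log δ := by rw [hc2]; field_simp
    have hrR : (r : ℝ) ≤ R + 1 := by
      have : r ≤ R + 1 := by omega
      exact_mod_cast this
    have hm : min c1 c2 * r * Real.log 2 ≤ c2 * (R + 1) * Real.log 2 := by
      gcongr
      exact min_le_right _ _
    nlinarith

/-- The failure probability of the test for weight `k` on an input of weight `j`, both shifted by
one. -/
theorem le_sq_two_mul_rpow_sub_one {N K J : ℝ} (hK : 1 ≤ K) (hKN : K ≤ N) (hJN : J ≤ N) :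
    ((J - K) / N) ^ 2 / 4 ≤ (2 * (2 : ℝ) ^ (-(J / K)) - 1) ^ 2 := by
  have hK0 : 0 < K := by linarith
  have hN0 : 0 < N := by linarith
  have e : 2 * (2 : ℝ) ^ (-(J / K)) = (2 : ℝ) ^ ((K - J) / K) := by
    have : (K - J) / K = 1 + -(J / K) := by field_simp; ring
    rw [this, Real.rpow_add two_pos, Real.rpow_one]
  rw [e]
  have hlog : 1 / 2 ≤ Real.log 2 := by have := Real.log_two_gt_d9; linarith
  have hpow : ∀ x : ℝ, (2 : ℝ) ^ x = Real.exp (Real.log 2 * x) := fun x =>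
    Real.rpow_def_of_pos two_pos x
  have habs : |(J - K) / N / 2| ≤ |(2 : ℝ) ^ ((K - J) / K) - 1| := by
    rcases le_total J K with h | h
    · have h1 : 0 ≤ (K - J) / K := div_nonneg (by linarith) hK0.le
      have h2 := Real.add_one_le_exp (Real.log 2 * ((K - J) / K))
      rw [← hpow] at h2
      have h3 : (K - J) / N ≤ (K - J) / K := by
        apply div_le_div_of_nonneg_left _ hK0 hKN; linarith
      have h4 : 0 ≤ (K - J) / N := div_nonneg (by linarith) hN0.le
      have h5 : (J - K) / N = -((K - J) / N) := by ring
      rw [h5, abs_of_nonpos (by linarith), abs_of_nonneg (by nlinarith)]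
      nlinarith
    · have h1 : 0 ≤ (J - K) / K := div_nonneg (by linarith) hK0.le
      have h4 : 0 ≤ (J - K) / N := div_nonneg (by linarith) hN0.le
      have h3 : (J - K) / N ≤ (J - K) / K := by
        apply div_le_div_of_nonneg_left _ hK0 hKN; linarith
      have h6 : (J - K) / N ≤ 1 := by rw [div_le_one hN0]; linarith
      set u := (J - K) / N with hu
      have h5 : (K - J) / K = -((J - K) / K) := by ring
      have h7 : (2 : ℝ) ^ ((K - J) / K) ≤ 1 - u / 2 := by
        calc (2 : ℝ) ^ ((K - J) / K) ≤ (2 : ℝ) ^ (-u) := by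
              apply Real.rpow_le_rpow_of_exponent_le one_le_two; linarith
          _ ≤ 1 - u / 2 := by
              -- Bernoulli's inequality for exponents in [0, 1]: (1/2)^u ≤ 1 - u/2.
              have h2 := rpow_one_add_le_one_add_mul_self (s := -1 / 2) (by norm_num) h4 h6
              rw [Real.rpow_neg zero_le_two, ← Real.inv_rpow zero_le_two]
              norm_num at h2 ⊢
              linarith
      rw [abs_of_nonneg (by linarith), abs_of_nonpos (by linarith)]
      linarith
  have := sq_le_sq.2 habs
  calc ((J - K) / N) ^ 2 / 4 = ((J - K) / N / 2) ^ 2 := by ring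
    _ ≤ _ := this

end QAC

/-! ### The weight tests and their combination. -/

namespace QAC

/-- The rotation used in the test for weight `k`. -/
noncomputable def weightRotation (k : ℕ) : Matrix.unitaryGroup Bool ℂ :=
  -- Chosen so that k + 1 damping factors have squared product 1/2.
  rotation (Real.arcsin ((2 : ℝ) ^ (-(1 / (2 * ((k : ℝ) + 1))))) / 2)

/-- The register of the weight test on an input `x`, with all work qubits zero. -/
def testInput {n : ℕ} (x : Fin n → Bool) : (Option (Fin n) × Bool) ⊕ Bool → Bool :=
  Sum.elim (fun p => !p.2 && p.1.elim false x) fun _ => false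

/-- The probability that the test for weight `k` passes on an input of weight `j`. -/
noncomputable def passProb (k j : ℕ) : ℝ :=
  1 - (2 * (2 : ℝ) ^ (-(((j : ℝ) + 1) / ((k : ℝ) + 1))) - 1) ^ 2 / 2

/-- The block `none` holds a 0 that the test flips, a constant bit 1. It shifts all weights by one,
so that weight 0 can be tested as well. -/
theorem measureProb_weightTest {n : ℕ} (k : ℕ) (x : Fin n → Bool) :
    measureProb (runGates (testLayers (weightRotation k) Option.isNone).flatten
      (basisState (testInput x))) (Sum.inr true) true = passProb k (hammingWeight x) := by
  have hk : (0 : ℝ) < (k : ℝ) + 1 := by positivity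
  set l : ℝ := (2 : ℝ) ^ (-(1 / (2 * ((k : ℝ) + 1)))) with hl
  have hl0 : 0 ≤ l := by positivity
  have hl1 : l ≤ 1 := Real.rpow_le_one_of_one_le_of_nonpos one_le_two (by
    rw [neg_nonpos]; positivity)
  have hsin : Real.sin (2 * (Real.arcsin l / 2)) = l := by
    rw [mul_div_cancel₀ _ (two_ne_zero), Real.sin_arcsin (by linarith) hl1]
  rw [measureProb_testLayers _ _ _ (fun t => t.elim true x) (by rintro (_ | i) <;> simp [testInput])
    (by simp [testInput]) (by simp [testInput])]
  simp only [weightRotation, ← hl, conjX_rotation, hsin]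
  rw [Fintype.prod_option]
  have hprod : (∏ i, if x i = true then (l : ℂ) else 1) = (l : ℂ) ^ hammingWeight x := by
    rw [Finset.prod_ite, Finset.prod_const, Finset.prod_const_one, mul_one]
    rfl
  simp only [Option.elim_none, Option.elim_some, if_true]
  have hpow : (l * l ^ hammingWeight x) ^ 2
      = (2 : ℝ) ^ (-(((hammingWeight x : ℝ) + 1) / ((k : ℝ) + 1))) := by
    rw [← pow_succ', ← pow_mul, hl, ← Real.rpow_natCast, ← Real.rpow_mul zero_le_two]
    congr 1
    push_cast
    field_simp
  rw [passProb, ← hpow, ← sq_abs (2 * (l * l ^ hammingWeight x) ^ 2 - 1), ← Real.norm_eq_abs,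
    ← Complex.norm_real]
  push_cast
  rw [← hprod]
  congr! 7

theorem passProb_self (k : ℕ) : passProb k k = 1 := by
  have hk : ((k : ℝ) + 1) ≠ 0 := by positivity
  rw [passProb, div_self hk, Real.rpow_neg_one]
  norm_num

theorem passProb_nonneg (k j : ℕ) : 0 ≤ passProb k j := by
  have h1 : (0 : ℝ) < (2 : ℝ) ^ (-(((j : ℝ) + 1) / ((k : ℝ) + 1))) := by positivity
  have h2 : (2 : ℝ) ^ (-(((j : ℝ) + 1) / ((k : ℝ) + 1))) ≤ 1 :=
    Real.rpow_le_one_of_one_le_of_nonpos one_le_two (by rw [neg_nonpos]; positivity)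
  unfold passProb
  nlinarith

/-- With D = |k - j| ≥ 1, one test passes with probability at most 1 - D²/(8(n+1)²) ≤
exp(-D/(8(n+1)²)). Weakening D² to D makes the bound geometric in D. -/
theorem passProb_pow_le {n k j : ℕ} (hk : k ≤ n) (hj : j ≤ n) (hkj : k ≠ j) (r : ℕ) :
    passProb k j ^ (r * (n + 1) ^ 2) ≤ ((Real.exp (-(1 / 16)) ^ 2) ^ r) ^ Nat.dist k j := by
  have hN : (0 : ℝ) < (n : ℝ) + 1 := by positivity
  have h := le_sq_two_mul_rpow_sub_one (N := (n : ℝ) + 1) (K := (k : ℝ) + 1) (J := (j : ℝ) + 1)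
    (by simp) (by simpa using hk) (by simpa using hj)
  have hd1 : 1 ≤ Nat.dist k j :=
    Nat.one_le_iff_ne_zero.2 fun h0 => hkj (Nat.eq_of_dist_eq_zero h0)
  have hd2 : ((Nat.dist k j : ℕ) : ℝ) ^ 2 = ((j : ℝ) + 1 - (k + 1)) ^ 2 := by
    rcases le_total k j with h | h
    · rw [Nat.dist_eq_sub_of_le h, Nat.cast_sub h]; ring
    · rw [Nat.dist_eq_sub_of_le_right h, Nat.cast_sub h]; ring
  set D : ℝ := ((Nat.dist k j : ℕ) : ℝ) with hD
  have hD1 : 1 ≤ D := by rw [hD]; exact_mod_cast hd1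
  have hle : passProb k j ≤ Real.exp (-(D / ((n : ℝ) + 1) ^ 2 / 8)) := by
    have e1 := Real.add_one_le_exp (-(D / ((n : ℝ) + 1) ^ 2 / 8))
    rw [div_pow, ← hd2] at h
    have e2 : D / ((n : ℝ) + 1) ^ 2 ≤ D ^ 2 / ((n : ℝ) + 1) ^ 2 := by
      gcongr
      nlinarith
    unfold passProb
    linarith
  refine (pow_le_pow_left₀ (passProb_nonneg k j) hle _).trans (le_of_eq ?_)
  rw [← pow_mul, ← pow_mul, ← Real.exp_nat_mul, ← Real.exp_nat_mul]
  congr 1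
  push_cast
  rw [← hD]
  field_simp
  ring

/-- The register of the weight tests: `s` blocks for every weight up to `n`, with a qubit for every
weight and an output qubit. -/
abbrev WeightRegister (n s : ℕ) : Type :=
  (Fin (n + 1) × ((Fin s × ((Option (Fin n) × Bool) ⊕ Bool)) ⊕ Unit)) ⊕ Unit

section Weight

set_option synthInstance.maxSize 1024

/-- The layers of the circuit which decides, given `s` copies for every weight, whether the input
has one of the weights in `A`. -/
noncomputable def weightLayers (n s : ℕ) [NeZero s] (A : Fin (n + 1) → Bool) :
    List (List (Gate (WeightRegister n s))) :=
  nandLayers 11 (fun k => nandLayers 9 (fun _ : Fin s =>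
    -- For a rejected weight the flags stay 0 through nine idle layers, so its NAND is surely 1 and
    -- never triggers the outer one.
    if A k then testLayers (weightRotation k) Option.isNone else List.replicate 9 [])
      (Sum.inr true)) (Sum.inr ())

theorem weightLayers_length (n s : ℕ) [NeZero s] (A : Fin (n + 1) → Bool) :
    (weightLayers n s A).length = 13 := nandLayers_length _ _ _

theorem disjoint_weightLayers (n s : ℕ) [NeZero s] (A : Fin (n + 1) → Bool) :
    ∀ l ∈ weightLayers n s A, DisjointGates l := by
  refine disjoint_nandLayers _ fun k => disjoint_nandLayers _ fun _ => ?_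
  split_ifs
  · exact disjoint_testLayers _ _
  · intro l hl
    rw [List.eq_of_mem_replicate hl]
    exact List.Pairwise.nil

/-- The register of `weightLayers` on copies of the input `x`, with all work qubits zero. -/
def weightInput {n : ℕ} (s : ℕ) (x : Fin n → Bool) : WeightRegister n s → Bool :=
  Sum.elim (fun p => Sum.elim (fun q => testInput x q.2) (fun _ => false) p.2) fun _ => false

theorem measureProb_weightLayers {n : ℕ} (s : ℕ) [NeZero s] (A : Fin (n + 1) → Bool)
    (x : Fin n → Bool) :
    measureProb (runGates (weightLayers n s A).flatten (basisState (weightInput s x)))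
      (Sum.inr ()) true
      = 1 - ∏ k, (1 - if A k then passProb k (hammingWeight x) ^ s else 0) := by
  rw [weightLayers, measureProb_nandLayers _ (fun k => nandLayers_length _ _ _) _ rfl]
  congr 1
  refine Finset.prod_congr rfl fun k _ => ?_
  rw [measureProb_nandLayers _ (fun t => by split_ifs <;> simp [testLayers]) _ rfl]
  congr 1
  have hin : ∀ t : Fin s, (fun w => weightInput s x (Sum.inl (k, Sum.inl (t, w)))) = testInput x :=
    fun t => rfl
  simp only [hin]
  split_ifs
  · rw [measureProb_weightTest, Finset.prod_const, Finset.card_univ, Fintype.card_fin]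
  · rw [Finset.prod_const, Finset.card_univ, Fintype.card_fin]
    have : measureProb (basisState (testInput x)) (Sum.inr true) true = 0 := by
      refine Finset.sum_eq_zero fun y _ => ?_
      split_ifs with h
      · have : y ≠ testInput x := by
          rintro rfl
          simp [testInput] at h
        simp [basisState, this]
      · rfl
    simp [this, NeZero.ne s]

end Weight

theorem card_weightRegister_le {n r : ℕ} (hr : 1 ≤ r) :
    (13 + 1) * Fintype.card (WeightRegister n (r * (n + 1) ^ 2)) ≤ 84 * (r * (n + 1)) ^ 84 := by
  have hs : n + 1 ≤ r * (n + 1) := Nat.le_mul_of_pos_left _ hr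
  have hs1 : 1 ≤ r * (n + 1) := by omega
  have hr' : r * (n + 1) ^ 2 ≤ (r * (n + 1)) ^ 2 := by
    rw [mul_pow]
    exact Nat.mul_le_mul_right _ (Nat.le_self_pow two_ne_zero r)
  simp only [Fintype.card_sum, Fintype.card_prod, Fintype.card_fin, Fintype.card_option,
    Fintype.card_bool, Fintype.card_unit]
  set u := r * (n + 1) with hu
  -- The factor is 14 · 6 = 84; the exponent 4 is raised to 84 because one constant serves as both.
  have h4 : (n + 1) * (r * (n + 1) ^ 2 * ((n + 1) * 2 + 2) + 1) + 1 ≤ 6 * u ^ 4 := by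
    calc (n + 1) * (r * (n + 1) ^ 2 * ((n + 1) * 2 + 2) + 1) + 1
        ≤ u * (u ^ 2 * (u * 2 + 2 * u) + u ^ 3) + u ^ 4 := by
          gcongr
          · omega
          · exact Nat.one_le_pow _ _ hs1
          · exact Nat.one_le_pow _ _ hs1
      _ = 6 * u ^ 4 := by ring
  have h84 : u ^ 4 ≤ u ^ 84 := Nat.pow_le_pow_right hs1 (by norm_num)
  omega

end QAC

/-! ### Assembling the circuit. -/

set_option synthInstance.maxSize 1024 in
theorem theorem4p4 :
    ∃ (d K : ℕ) (c : ℝ), 0 < c ∧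
      ∀ (n : ℕ) (f : (Fin n → Bool) → Bool), QAC.IsSymmetric f →
        ∀ r : ℕ, 1 ≤ r →
          ∃ (a : ℕ) (C : QAC.Circuit (QAC.Register (Fin (r * (n + 1) ^ 3) × Fin n) a)),
            C.depth ≤ d ∧
            C.size ≤ K * (r * (n + 1)) ^ K ∧
            ∀ x : Fin n → Bool,
              (f x = true →
                C.outputProb (QAC.copies (r * (n + 1) ^ 3) x) true = 1) ∧
              (f x = false →
                C.outputProb (QAC.copies (r * (n + 1) ^ 3) x) true ≤ (2 : ℝ) ^ (-(c * (r : ℝ))) ∧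
                1 - (2 : ℝ) ^ (-(c * (r : ℝ))) ≤
                  C.outputProb (QAC.copies (r * (n + 1) ^ 3) x) false) := by
  set s0 : ℝ := Real.exp (-(1 / 16)) with hs0
  have hs0pos : 0 < s0 := Real.exp_pos _
  have hs0lt : s0 < 1 := by rw [hs0, Real.exp_lt_one_iff]; norm_num
  have hs2 : s0 ^ 2 < 1 := pow_lt_one₀ hs0pos.le hs0lt two_ne_zero
  have hB : 0 < 2 / (1 - s0 ^ 2) ^ 2 := by
    have : 0 < 1 - s0 ^ 2 := by linarith
    positivity
  obtain ⟨c, hc, hrate⟩ := QAC.exists_rate _ s0 hB hs0pos hs0lt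
  refine ⟨13, 84, c, hc, fun n f hf r hr => ?_⟩
  set s := r * (n + 1) ^ 2 with hs
  have : NeZero s := ⟨by positivity⟩
  let A : Fin (n + 1) → Bool := fun k =>
    @decide (∃ x, QAC.hammingWeight x = k ∧ f x = true) (Classical.propDecidable _)
  -- The copies are dealt out as `s` for each of the n + 1 weights.
  let σ : Fin (r * (n + 1) ^ 3) ≃ Fin (n + 1) × Fin s :=
    (finCongr (by rw [hs]; ring)).trans finProdFinEquiv.symm
  let inp : Fin (r * (n + 1) ^ 3) × Fin n → QAC.WeightRegister n s :=
    fun p => Sum.inl ((σ p.1).1, Sum.inl ((σ p.1).2, Sum.inl (some p.2, false)))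
  have hinp : Function.Injective inp := by
    rintro ⟨p, i⟩ ⟨q, j⟩ h
    simp only [inp, Sum.inl.injEq, Prod.mk.injEq, Option.some.injEq, and_true] at h
    rw [Prod.mk.injEq]
    exact ⟨σ.injective (Prod.ext h.1 h.2.1), h.2.2⟩
  obtain ⟨a, C, hdepth, hsize, hC⟩ := QAC.exists_circuit_of_layers inp hinp (Sum.inr ())
    (fun i => Sum.inl_ne_inr) (QAC.weightLayers n s A) (QAC.disjoint_weightLayers n s A)
  rw [QAC.weightLayers_length] at hdepth hsize
  refine ⟨a, C, hdepth.le, hsize.trans (QAC.card_weightRegister_le hr), fun x => ?_⟩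
  have hout : ∀ b, C.outputProb (QAC.copies (r * (n + 1) ^ 3) x) b
      = QAC.measureProb (QAC.runGates (QAC.weightLayers n s A).flatten
          (QAC.basisState (QAC.weightInput s x))) (Sum.inr ()) b := by
    refine hC _ _ (fun i => by simp [inp, QAC.weightInput, QAC.testInput, QAC.copies]) ?_
    rintro (⟨k, ⟨t, (⟨_ | i, _ | _⟩ | e)⟩ | _⟩ | _) hq <;>
      simp [QAC.weightInput, QAC.testInput]
    exact absurd (by simp [inp]) (hq (σ.symm (k, t), i))
  have hw : QAC.hammingWeight x < n + 1 := by
    have := Finset.card_le_univ (Finset.univ.filter fun i => x i = true)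
    rw [Fintype.card_fin] at this
    exact Nat.lt_succ_of_le this
  have htrue := (hout true).trans (QAC.measureProb_weightLayers s A x)
  have hfalse : C.outputProb (QAC.copies (r * (n + 1) ^ 3) x) false
      = 1 - C.outputProb (QAC.copies (r * (n + 1) ^ 3) x) true := by
    rw [hout, hout, QAC.measureProb_true_runGates]
    ring
  refine ⟨fun hfx => ?_, fun hfx => ?_⟩
  -- The factor of the true weight vanishes, since its tests pass surely.
  · rw [htrue, Finset.prod_eq_zero (Finset.mem_univ ⟨_, hw⟩), sub_zero]
    rw [if_pos (by simpa [A] using ⟨x, rfl, hfx⟩), QAC.passProb_self, one_pow, sub_self]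
  · have hprod := QAC.exp_le_prod_one_sub (s := (s0 ^ 2) ^ r) (by positivity)
      (pow_lt_one₀ (by positivity) hs2 (by omega)) (⟨_, hw⟩ : Fin (n + 1))
      (fun k => if A k then QAC.passProb k (QAC.hammingWeight x) ^ s else 0)
      (by
        -- Symmetry enters here: no string of the weight of `x` is accepted, so the true weight is
        -- not tested.
        rw [if_neg]
        simp only [A, decide_eq_true_eq, not_exists, not_and, Bool.not_eq_true]
        intro x' hx'
        rw [hf x' x hx', hfx])
      (fun k hk => by
        split_ifs
        · exact QAC.passProb_pow_le (Nat.lt_succ_iff.1 k.2) (Nat.lt_succ_iff.1 hw)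
            (fun h => hk (Fin.ext h)) r
        · positivity)
    have hmain : C.outputProb (QAC.copies (r * (n + 1) ^ 3) x) true ≤ (2 : ℝ) ^ (-(c * (r : ℝ))) := by
      refine le_trans ?_ (hrate r hr)
      rw [htrue]
      refine sub_le_sub_left (le_trans ?_ hprod) 1
      rw [Real.exp_le_exp, neg_le_neg_iff, mul_div_right_comm]
      -- Bounding the denominator by its value at r = 1 makes the constant of `exists_rate`
      -- independent of r.
      have hle : (s0 ^ 2) ^ r ≤ s0 ^ 2 := pow_le_of_le_one (by positivity) hs2.le (by omega)
      gcongr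
    refine ⟨hmain, ?_⟩
    rw [hfalse]
    linarith
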